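/- Let $P$ be an associative ring with identity. For a locally finite preordered set $\Lambda$ (every interval $[s,t]=\{r: s\preceq r\preceq t\}$ is finite), let $\mathrm{M}_\Lambda(P)$ be the incidence ring of $\Lambda$ over $P$: the set of all $(a_{s,t})\in P^{\Lambda\times\Lambda}$ with $a_{s,t}=0$ whenever $s\not\preceq t$, with coordinatewise addition and with product $(ab)_{s,t}=\sum_{r\in[s,t]}a_{s,r}b_{r,t}$. If $P$ is a topological ring, then $\mathrm{M}_\Lambda(P)$ carries the subspace topology of $P^{\Lambda\times\Lambda}$. For $m,n\in\mathbb{N}=\{0,1,2,\dots\}$ let $\mathbf{m}\leftarrow\mathbf{n}$ be the preordered set with elements $0',\dots,(m-1)',0,\dots,n-1$ in which the primed elements are pairwise equivalent, the unprimed elements are pairwise equivalent, and every primed element is strictly below every unprimed one. Then the class of incidence rings over $P$ is generated by the rings $\mathrm{M}_{\mathbf{m}\leftarrow\mathbf{n}}(P)$, $m,n\in\mathbb{N}$, under products, inverse limits and pullbacks, in the following sense. 1. For every locally finite partially ordered set $\Lambda$, the ring $\mathrm{M}_\Lambda(P)$ belongs to the smallest class of rings that contains all $\mathrm{M}_{\mathbf{m}\leftarrow\mathbf{n}}(P)$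 and is closed under isomorphisms, arbitrary products, inverse limits over (non-empty) directed sets, and pullbacks (the limits being taken in the category of rings and unital ring homomorphisms). 2. The class of all rings isomorphic to $\mathrm{M}_\Lambda(P)$ for some locally finite preordered set $\Lambda$ is equal to the smallest class of rings that contains all $\mathrm{M}_{\mathbf{m}\leftarrow\mathbf{n}}(P)$ and contains every incidence ring over $P$ that is a product, an inverse limit over a directed set, or a pullback of rings of the class. If $P$ is a topological ring, then 1 and 2 also hold for topological rings, with isomorphisms and limits taken in the category of topological rings and continuous unital ring homomorphisms. -/

import Mathlib

open CategoryTheory CategoryTheory.Limits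

universe u v w

/-- The underlying set `{0', …, (m-1)', 0, …, n-1}` of the preordered set `m ← n`. -/
def TwoBlock (m n : ℕ) : Type := Fin m ⊕ Fin n

namespace TwoBlock

instance instDecidableEq (m n : ℕ) : DecidableEq (TwoBlock m n) := inferInstanceAs (DecidableEq (Fin m ⊕ Fin n))

instance instFintype (m n : ℕ) : Fintype (TwoBlock m n) := inferInstanceAs (Fintype (Fin m ⊕ Fin n))

/-- The primed elements are pairwise equivalent, the unprimed elements are pairwise equivalent, and
every primed element is strictly below every unprimed one: the order is pulled back from
`false < true` along the map that tells the unprimed elements from the primed ones. -/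
instance instPreorder (m n : ℕ) : Preorder (TwoBlock m n) := Preorder.lift (fun x => Sum.isRight x)

instance instDecidableLE (m n : ℕ) : DecidableLE (TwoBlock m n) :=
  fun x y => inferInstanceAs (Decidable (Sum.isRight x ≤ Sum.isRight y))

instance instLocallyFiniteOrder (m n : ℕ) : LocallyFiniteOrder (TwoBlock m n) :=
  Fintype.toLocallyFiniteOrder

end TwoBlock

namespace IncidenceAlgebra

variable {P : Type u} {Λ : Type v} [Ring P] [TopologicalSpace P]

/-- The subspace topology of `P ^ (Λ × Λ)` on the incidence ring. -/
instance instTopologicalSpace [LE Λ] : TopologicalSpace (IncidenceAlgebra P Λ) :=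
  TopologicalSpace.induced (fun A (s t : Λ) => A s t) inferInstance

theorem continuous_apply_apply [LE Λ] (s t : Λ) :
    Continuous fun A : IncidenceAlgebra P Λ => A s t :=
  (continuous_apply t).comp ((continuous_apply s).comp continuous_induced_dom)

theorem continuous_of_apply [LE Λ] {X : Type w} [TopologicalSpace X]
    {f : X → IncidenceAlgebra P Λ} (h : ∀ s t, Continuous fun x => f x s t) : Continuous f :=
  continuous_induced_rng.2 (continuous_pi fun s => continuous_pi fun t => h s t)

instance instIsTopologicalRing [Preorder Λ] [LocallyFiniteOrder Λ] [DecidableEq Λ]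
    [IsTopologicalRing P] :
    IsTopologicalRing (IncidenceAlgebra P Λ) where
  continuous_add := continuous_of_apply fun s t =>
    ((continuous_apply_apply s t).comp continuous_fst).add
      ((continuous_apply_apply s t).comp continuous_snd)
  continuous_mul := continuous_of_apply fun s t => by
    simp only [mul_apply]
    exact continuous_finsetSum _ fun r _ =>
      ((continuous_apply_apply s r).comp continuous_fst).mul
        ((continuous_apply_apply r t).comp continuous_snd)
  continuous_neg := continuous_of_apply fun s t => (continuous_apply_apply s t).neg

end IncidenceAlgebra

/-- A bundled topological ring (associative, with identity, not necessarily commutative). -/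
structure TopRingCat where
  of ::
  carrier : Type u
  [ring : Ring carrier]
  [topologicalSpace : TopologicalSpace carrier]
  [isTopologicalRing : IsTopologicalRing carrier]

namespace TopRingCat

instance instCoeSort : CoeSort TopRingCat.{u} (Type u) := ⟨TopRingCat.carrier⟩

attribute [instance] ring topologicalSpace isTopologicalRing

/-- The morphisms of topological rings are the continuous (unital) ring homomorphisms. -/
instance instCategory : Category TopRingCat.{u} where
  Hom R S := { f : R →+* S // Continuous f }
  id R := ⟨RingHom.id R, continuous_id⟩
  comp f g := ⟨g.1.comp f.1, g.2.comp f.2⟩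

end TopRingCat

/-- `GeneratedWithin A G` is the smallest class of objects that contains `G` and contains every
object of `A` which is a product, an inverse limit over a directed set, or a pullback of a diagram
whose objects all lie in the class. With `A = ⊤` this is the class generated by `G` under products,
inverse limits and pullbacks. (Limits are meant up to isomorphism; for instance, an object that is
isomorphic to `X` is a product of the one-member family `X`.) -/
inductive GeneratedWithin {C : Type v} [Category.{u} C] (A G : ObjectProperty C) :
    ObjectProperty C
  | generator (X : C) (hX : G X) : GeneratedWithin A G X
  | product (I : Type u) (F : I → C) (c : Fan F) (hc : Nonempty (IsLimit c)) (hA : A c.pt)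
      (hF : ∀ i, GeneratedWithin A G (F i)) : GeneratedWithin A G c.pt
  | inverseLimit (I : Type u) [Preorder I] [IsDirectedOrder I] [Nonempty I] (F : Iᵒᵖ ⥤ C)
      (c : Cone F) (hc : Nonempty (IsLimit c)) (hA : A c.pt)
      (hF : ∀ i, GeneratedWithin A G (F.obj i)) : GeneratedWithin A G c.pt
  | pullback (W X Y Z : C) (fst : W ⟶ X) (snd : W ⟶ Y) (f : X ⟶ Z) (g : Y ⟶ Z)
      (h : IsPullback fst snd f g) (hA : A W) (hX : GeneratedWithin A G X)
      (hY : GeneratedWithin A G Y) (hZ : GeneratedWithin A G Z) : GeneratedWithin A G W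

/-- The rings `M_{m ← n}(P)`, for `m n : ℕ`. -/
def blockRings (P : Type u) [Ring P] : ObjectProperty RingCat.{u} :=
  fun R => ∃ m n : ℕ, R = RingCat.of (IncidenceAlgebra P (TwoBlock m n))

/-- The rings isomorphic to `M_Λ(P)` for some locally finite preordered set `Λ`. -/
def incidenceRings (P : Type u) [Ring P] : ObjectProperty RingCat.{u} :=
  fun R => ∃ (Λ : Type u) (_ : Preorder Λ) (_ : LocallyFiniteOrder Λ) (_ : DecidableEq Λ),
    Nonempty (R ≅ RingCat.of (IncidenceAlgebra P Λ))

/-- The topological rings `M_{m ← n}(P)`, for `m n : ℕ`. -/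
def topBlockRings (P : Type u) [Ring P] [TopologicalSpace P] [IsTopologicalRing P] :
    ObjectProperty TopRingCat.{u} :=
  fun R => ∃ m n : ℕ, R = TopRingCat.of (IncidenceAlgebra P (TwoBlock m n))

/-- The topological rings isomorphic to `M_Λ(P)` for some locally finite preordered set `Λ`. -/
def topIncidenceRings (P : Type u) [Ring P] [TopologicalSpace P] [IsTopologicalRing P] :
    ObjectProperty TopRingCat.{u} :=
  fun R => ∃ (Λ : Type u) (_ : Preorder Λ) (_ : LocallyFiniteOrder Λ) (_ : DecidableEq Λ),
    Nonempty (R ≅ TopRingCat.of (IncidenceAlgebra P Λ))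

/-!
A finite preorder is the intersection, over finitely many subsets `u`, of the preorders in which
`x ≤ y` means that `x ∈ u` implies `y ∈ u`; each of these is of the form `m ← n`. Intersecting two
preorders on a finite set amounts to intersecting their incidence rings inside the full matrix ring,
which is a pullback and is itself an incidence ring; the full matrix ring is `M_{0 ← n}(P)` or
`M_{n ← 0}(P)`. For an arbitrary locally finite `Λ`, the finite order-convex subsets form a directed
system, and an element of `M_Λ(P)` is the same as a compatible family of restrictions to them, so
`M_Λ(P)` is an inverse limit of incidence rings of finite preorders.

All of this is done for topological rings. Giving `P` the discrete topology and then forgetting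
topologies, which preserves limits because it is right adjoint to the discrete topology, yields the
statement for rings.
-/

/-- The injections of preordered sets `Γ → Λ` along which matrices in `M_Λ(P)` may be restricted to
matrices in `M_Γ(P)`. The order is reflected but need not be preserved, so this covers both the
inclusions of order-convex subsets and the identity map of a set from a preorder to one with fewer
relations. -/
structure IsConvexInjection {Γ Λ : Type*} [Preorder Γ] [Preorder Λ] (g : Γ → Λ) : Prop where
  injective : Function.Injective g
  le_of_map_le {s t : Γ} : g s ≤ g t → s ≤ t
  ordConnected_range : (Set.range g).OrdConnected

namespace IsConvexInjection

open IncidenceAlgebra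

section Preorder

variable {Γ Λ : Type*} [Preorder Γ] [Preorder Λ]

theorem of_orderIso (e : Γ ≃o Λ) : IsConvexInjection e :=
  ⟨e.injective, e.le_iff_le.1, Set.ordConnected_range e⟩

theorem subtypeVal {s : Set Λ} (hs : s.OrdConnected) : IsConvexInjection (Subtype.val : s → Λ) :=
  ⟨Subtype.val_injective, id, by rwa [Subtype.range_val]⟩

theorem inclusion {s t : Set Λ} (hs : s.OrdConnected) (h : s ⊆ t) :
    IsConvexInjection (Set.inclusion h) :=
  ⟨Set.inclusion_injective h, id, by
    rw [Set.range_inclusion]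
    exact hs.preimage_mono (Subtype.mono_coe t)⟩

end Preorder

section Restrict

variable {P Γ Λ : Type*} [Preorder Γ] [Preorder Λ] [LocallyFiniteOrder Γ] [LocallyFiniteOrder Λ]
  {g : Γ → Λ}

theorem sum_Icc_map (hg : IsConvexInjection g) {M : Type*} [AddCommMonoid M] {s t : Γ} (f : Λ → M)
    (hf : ∀ q, ¬(g s ≤ g q ∧ g q ≤ g t) → f (g q) = 0) :
    ∑ r ∈ Finset.Icc (g s) (g t), f r = ∑ q ∈ Finset.Icc s t, f (g q) := by
  refine (Finset.sum_subset (s₂ := (Finset.Icc s t).map ⟨g, hg.injective⟩) ?_ ?_).trans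
    (Finset.sum_map _ _ _)
  · intro r hr
    rw [Finset.mem_Icc] at hr
    obtain ⟨q, rfl⟩ := hg.ordConnected_range.out ⟨s, rfl⟩ ⟨t, rfl⟩ hr
    exact Finset.mem_map_of_mem _
      (Finset.mem_Icc.2 ⟨hg.le_of_map_le hr.1, hg.le_of_map_le hr.2⟩)
  · intro r hr hr'
    obtain ⟨q, -, rfl⟩ := Finset.mem_map.1 hr
    exact hf q (mt Finset.mem_Icc.2 hr')

variable [NonAssocSemiring P] [DecidableEq Γ] [DecidableEq Λ]

/-- The ring homomorphism `M_Λ(P) → M_Γ(P)` that restricts matrices along `g`. -/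
def restrict (hg : IsConvexInjection g) : IncidenceAlgebra P Λ →+* IncidenceAlgebra P Γ where
  toFun A := ⟨fun s t => A (g s) (g t), fun _ _ h =>
    apply_eq_zero_of_not_le (mt hg.le_of_map_le h) A⟩
  map_zero' := rfl
  map_add' _ _ := rfl
  map_one' := by
    ext s t _
    simp [hg.injective.eq_iff]
  map_mul' A B := by
    ext s t _
    refine hg.sum_Icc_map (fun r => A (g s) r * B r (g t)) fun q hq => ?_
    rcases not_and_or.1 hq with hq | hq
    · rw [apply_eq_zero_of_not_le hq, zero_mul]
    · rw [apply_eq_zero_of_not_le hq, mul_zero]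

theorem restrict_apply (hg : IsConvexInjection g) (A : IncidenceAlgebra P Λ) (s t : Γ) :
    hg.restrict A s t = A (g s) (g t) :=
  rfl

/-- The isomorphism of incidence rings that relabels matrices along an order isomorphism. -/
def restrictEquiv (e : Γ ≃o Λ) : IncidenceAlgebra P Λ ≃+* IncidenceAlgebra P Γ :=
  RingEquiv.ofRingHom (of_orderIso e).restrict (of_orderIso e.symm).restrict
    (by ext A s t _; simp [restrict_apply]) (by ext A s t _; simp [restrict_apply])

end Restrict

section Topology

variable {P Γ Λ : Type*} [Ring P] [TopologicalSpace P] [Preorder Γ] [Preorder Λ]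
  [LocallyFiniteOrder Γ] [LocallyFiniteOrder Λ] [DecidableEq Γ] [DecidableEq Λ] {g : Γ → Λ}

theorem continuous_restrict (hg : IsConvexInjection g) : Continuous (hg.restrict (P := P)) :=
  continuous_of_apply fun s t => continuous_apply_apply (g s) (g t)

theorem continuous_restrictEquiv (e : Γ ≃o Λ) : Continuous (restrictEquiv (P := P) e) :=
  (of_orderIso e).continuous_restrict

theorem continuous_restrictEquiv_symm (e : Γ ≃o Λ) :
    Continuous (restrictEquiv (P := P) e).symm :=
  (of_orderIso e.symm).continuous_restrict

theorem isEmbedding_pi_restrict {ι : Type*} {Γ : ι → Type*} [∀ i, Preorder (Γ i)]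
    [∀ i, LocallyFiniteOrder (Γ i)] [∀ i, DecidableEq (Γ i)] {g : ∀ i, Γ i → Λ}
    (hg : ∀ i, IsConvexInjection (g i))
    (hcover : ∀ s t, ∃ i a b, g i a = s ∧ g i b = t) :
    Topology.IsEmbedding fun (A : IncidenceAlgebra P Λ) i => (hg i).restrict A := by
  choose i a b ha hb using hcover
  let entries (B : ∀ i, IncidenceAlgebra P (Γ i)) (s t : Λ) : P := B (i s t) (a s t) (b s t)
  have hentries (A : IncidenceAlgebra P Λ) : entries (fun i => (hg i).restrict A) = A := by
    funext s t
    simp only [entries, restrict_apply, ha, hb]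
  refine .of_comp (g := entries) (continuous_pi fun i => (hg i).continuous_restrict)
    (continuous_pi fun s => continuous_pi fun t =>
      (IncidenceAlgebra.continuous_apply_apply _ _).comp (continuous_apply (i s t))) ?_
  rw [show entries ∘ _ = _ from funext hentries]
  exact ⟨⟨rfl⟩, DFunLike.coe_injective⟩

end Topology

end IsConvexInjection

namespace TopRingCat

/-- The forgetful functor from topological rings to rings. -/
def forgetTopology : TopRingCat.{u} ⥤ RingCat.{u} where
  obj R := RingCat.of R
  map f := RingCat.ofHom f.1

/-- The functor that equips a ring with the discrete topology. -/
def discrete : RingCat.{u} ⥤ TopRingCat.{u} where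
  obj R :=
    letI : TopologicalSpace R := ⊥
    haveI : DiscreteTopology R := ⟨rfl⟩
    TopRingCat.of R
  map f := ⟨f.hom, continuous_bot⟩

/-- The discrete topology is left adjoint to forgetting the topology; this is what makes
`forgetTopology` preserve limits. -/
def discreteAdjunction : discrete.{u} ⊣ forgetTopology.{u} :=
  Adjunction.mkOfHomEquiv
    { homEquiv := fun _ _ =>
        { toFun := fun f => RingCat.ofHom f.1
          invFun := fun f => ⟨f.hom, continuous_bot⟩
          left_inv := fun _ => rfl
          right_inv := fun _ => rfl }
      homEquiv_naturality_left_symm := fun _ _ => rfl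
      homEquiv_naturality_right := fun _ _ => rfl }

instance instIsRightAdjointForgetTopology : forgetTopology.{u}.IsRightAdjoint :=
  discreteAdjunction.isRightAdjoint

/-- The isomorphism of topological rings given by a ring isomorphism that is a homeomorphism. -/
def isoOfRingEquiv {R S : Type u} [Ring R] [TopologicalSpace R] [IsTopologicalRing R] [Ring S]
    [TopologicalSpace S] [IsTopologicalRing S] (e : R ≃+* S) (he : Continuous e)
    (he' : Continuous e.symm) : of R ≅ of S where
  hom := ⟨e, he⟩
  inv := ⟨e.symm, he'⟩
  hom_inv_id := Subtype.ext (RingHom.ext e.symm_apply_apply)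
  inv_hom_id := Subtype.ext (RingHom.ext e.apply_symm_apply)

theorem comp_apply {R S T : TopRingCat.{u}} (f : R ⟶ S) (g : S ⟶ T) (x : R) :
    (f ≫ g).1 x = g.1 (f.1 x) :=
  rfl

theorem nonempty_isLimit_of_isEmbedding {J : Type w} [Category.{v} J] {F : J ⥤ TopRingCat.{u}}
    (c : Cone F) (hemb : Topology.IsEmbedding fun (y : c.pt) j => (c.π.app j).1 y)
    (hsurj : ∀ x : ∀ j, F.obj j, (∀ {i j} (f : i ⟶ j), (F.map f).1 (x i) = x j) →
      ∃ y : c.pt, ∀ j, (c.π.app j).1 y = x j) :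
    Nonempty (IsLimit c) := by
  have hlift (s : Cone F) (t : s.pt) : ∃ y : c.pt, ∀ j, (c.π.app j).1 y = (s.π.app j).1 t :=
    hsurj _ fun {i j} f => by rw [← comp_apply, s.w]
  choose lift hlift using hlift
  have hinj {x y : c.pt} (h : ∀ j, (c.π.app j).1 x = (c.π.app j).1 y) : x = y :=
    hemb.injective (funext h)
  have hcont (s : Cone F) : Continuous (lift s) :=
    hemb.continuous_iff.2 (continuous_pi fun j => (s.π.app j).2.congr fun t => (hlift s t j).symm)
  exact ⟨{
    lift := fun s => ⟨
      { toFun := lift s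
        map_zero' := hinj fun j => by simp only [hlift, map_zero]
        map_one' := hinj fun j => by simp only [hlift, map_one]
        map_add' := fun x y => hinj fun j => by simp only [hlift, map_add]
        map_mul' := fun x y => hinj fun j => by simp only [hlift, map_mul] },
      hcont s⟩
    fac := fun s j => Subtype.ext (RingHom.ext fun t => hlift s t j)
    uniq := fun s m hm => Subtype.ext (RingHom.ext fun t => hinj fun j =>
      ((congrArg (fun f => f.1 t) (hm j)).trans (hlift s t j).symm :)) }⟩

theorem isPullback_of_isEmbedding {W X Y Z : TopRingCat.{u}} {fst : W ⟶ X} {snd : W ⟶ Y}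
    {f : X ⟶ Z} {g : Y ⟶ Z} (comm : fst ≫ f = snd ≫ g)
    (hemb : Topology.IsEmbedding fun w => (fst.1 w, snd.1 w))
    (hsurj : ∀ x y, f.1 x = g.1 y → ∃ w, fst.1 w = x ∧ snd.1 w = y) :
    IsPullback fst snd f g := by
  refine ⟨⟨comm⟩, nonempty_isLimit_of_isEmbedding _ ?_ fun x hx => ?_⟩
  · refine .of_comp (g := fun x : ∀ j, (cospan f g).obj j => ((x .left : X), (x .right : Y)))
      (continuous_pi fun j => ?_) ((continuous_apply _).prodMk (continuous_apply _)) hemb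
    exact ((PullbackCone.mk fst snd comm).π.app j).2
  · have hleft : f.1 (x .left) = x .one := hx WalkingCospan.Hom.inl
    have hright : g.1 (x .right) = x .one := hx WalkingCospan.Hom.inr
    obtain ⟨w, hfst, hsnd⟩ := hsurj _ _ (hleft.trans hright.symm)
    refine ⟨w, ?_⟩
    rintro (_ | _ | _)
    · exact (congrArg f.1 hfst).trans hleft
    · exact hfst
    · exact hsnd

end TopRingCat

namespace GeneratedWithin

variable {C : Type*} [Category.{u} C] {A A' G : ObjectProperty C}

theorem mono (h : A ≤ A') : GeneratedWithin A G ≤ GeneratedWithin A' G := by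
  intro X hX
  induction hX with
  | generator X hX => exact generator X hX
  | product I F c hc hA _ ih => exact product I F c hc (h _ hA) ih
  | inverseLimit I F c hc hA _ ih => exact inverseLimit I F c hc (h _ hA) ih
  | pullback W X Y Z fst snd f g hp hA _ _ _ ihX ihY ihZ =>
    exact pullback W X Y Z fst snd f g hp (h _ hA) ihX ihY ihZ

theorem le_of_le (h : G ≤ A) : GeneratedWithin A G ≤ A := by
  intro X hX
  cases hX with
  | generator X hX => exact h _ hX
  | product I F c hc hA => exact hA
  | inverseLimit I F c hc hA => exact hA
  | pullback W X Y Z fst snd f g hp hA => exact hA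

theorem of_iso {X Y : C} (e : X ≅ Y) (hA : A X) (hY : GeneratedWithin A G Y) :
    GeneratedWithin A G X :=
  pullback X Y Y Y e.hom e.hom (𝟙 Y) (𝟙 Y) (IsPullback.of_vert_isIso ⟨rfl⟩) hA hY hY hY

theorem map {D : Type*} [Category.{u} D] {B H : ObjectProperty D} (U : C ⥤ D) [PreservesLimits U]
    (hAB : ∀ X, A X → B (U.obj X)) (hGH : ∀ X, G X → H (U.obj X)) {X : C}
    (hX : GeneratedWithin A G X) : GeneratedWithin B H (U.obj X) := by
  induction hX with
  | generator X hX => exact generator _ (hGH _ hX)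
  | product I F c hc hA _ ih =>
    exact product I _ _ (hc.map fun h => Fan.isLimitMapConeEquiv U F c (isLimitOfPreserves U h))
      (hAB _ hA) ih
  | inverseLimit I F c hc hA _ ih =>
    exact inverseLimit I (F ⋙ U) (U.mapCone c) (hc.map fun h => isLimitOfPreserves U h)
      (hAB _ hA) ih
  | pullback W X Y Z fst snd f g hp hA _ _ _ ihX ihY ihZ =>
    exact pullback _ _ _ _ _ _ _ _ (hp.map U) (hAB _ hA) ihX ihY ihZ

end GeneratedWithin

theorem TwoBlock.exists_orderIso {Λ : Type*} [Preorder Λ] [Finite Λ] (u : Set Λ)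
    (hu : ∀ s t, s ≤ t ↔ (s ∈ u → t ∈ u)) : ∃ m n : ℕ, Nonempty (Λ ≃o TwoBlock m n) := by
  classical
  let e : TwoBlock (Nat.card ↥uᶜ) (Nat.card u) ≃ Λ :=
    (Equiv.sumCongr (Finite.equivFin _).symm (Finite.equivFin _).symm).trans
      ((Equiv.sumComm _ _).trans (Equiv.Set.sumCompl u))
  have he : ∀ x, e x ∈ u ↔ Sum.isRight x = true := by
    rintro (x | x)
    · exact iff_of_false ((Finite.equivFin ↥uᶜ).symm x).2 Bool.false_ne_true
    · exact iff_of_true ((Finite.equivFin u).symm x).2 rfl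
  refine ⟨_, _, ⟨OrderIso.symm ⟨e, fun {x y} => ?_⟩⟩⟩
  rw [hu, he, he]
  exact Iff.rfl

/-- The set `α` with the largest preorder for which all members of `U` are upper sets. Passing from
`U` to `U ∪ V` intersects the preorders of `U` and `V`. -/
def WithUpperSets {α : Type v} (_ : Set (Set α)) : Type v := α

namespace WithUpperSets

variable {α : Type v} {U V : Set (Set α)}

/-- The points of `WithUpperSets U` are those of `α`. -/
def equiv (U : Set (Set α)) : α ≃ WithUpperSets U := Equiv.refl α

instance instPreorder : Preorder (WithUpperSets U) where
  le s t := ∀ u ∈ U, (equiv U).symm s ∈ u → (equiv U).symm t ∈ u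
  le_refl _ _ _ h := h
  le_trans _ _ _ hst htr u hu h := htr u hu (hst u hu h)

theorem le_iff {s t : WithUpperSets U} :
    s ≤ t ↔ ∀ u ∈ U, (equiv U).symm s ∈ u → (equiv U).symm t ∈ u :=
  Iff.rfl

instance instFinite [Finite α] : Finite (WithUpperSets U) := inferInstanceAs (Finite α)

noncomputable instance instLocallyFiniteOrder [Finite α] :
    LocallyFiniteOrder (WithUpperSets U) := by
  classical
  have := Fintype.ofFinite (WithUpperSets U)
  exact Fintype.toLocallyFiniteOrder

noncomputable instance instDecidableEq : DecidableEq (WithUpperSets U) := Classical.decEq _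

/-- The identity map of `α`, regarded as a map between two of its preorders. -/
def reorder (U V : Set (Set α)) : WithUpperSets U ≃ WithUpperSets V :=
  (equiv U).symm.trans (equiv V)

theorem isConvexInjection_reorder (h : U ⊆ V) : IsConvexInjection (reorder U V) where
  injective := (reorder U V).injective
  le_of_map_le hst u hu := hst u (h hu)
  ordConnected_range := by
    rw [(reorder U V).range_eq_univ]
    exact Set.ordConnected_univ

/-- A preorder is determined by its principal upper sets. -/
def orderIsoRangeIci (Λ : Type v) [Preorder Λ] :
    Λ ≃o WithUpperSets (Set.range (Set.Ici : Λ → Set Λ)) where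
  toEquiv := equiv _
  map_rel_iff' {s t} := by
    simp only [le_iff, Set.forall_mem_range, Equiv.symm_apply_apply, Set.mem_Ici]
    exact ⟨fun h => h s le_rfl, fun hst r hrs => hrs.trans hst⟩

theorem exists_orderIso_twoBlock_singleton [Finite α] (u : Set α) :
    ∃ m n : ℕ, Nonempty (WithUpperSets {u} ≃o TwoBlock m n) :=
  TwoBlock.exists_orderIso ((equiv {u}).symm ⁻¹' u) fun s t => by
    simp only [le_iff, Set.mem_singleton_iff, forall_eq, Set.mem_preimage]

theorem exists_orderIso_twoBlock_empty [Finite α] :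
    ∃ m n : ℕ, Nonempty (WithUpperSets (∅ : Set (Set α)) ≃o TwoBlock m n) :=
  TwoBlock.exists_orderIso ∅ fun s t => by
    simp only [le_iff, Set.mem_empty_iff_false, false_imp_iff, implies_true]

end WithUpperSets

section IntervalHull

variable {Λ : Type*} [Preorder Λ] [LocallyFiniteOrder Λ] [DecidableEq Λ]

/-- The order-convex hull of a finite subset of a locally finite preorder, which is again finite. -/
def intervalHull (s : Finset Λ) : Finset Λ :=
  s.biUnion fun a => s.biUnion fun b => Finset.Icc a b

theorem mem_intervalHull {s : Finset Λ} {r : Λ} :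
    r ∈ intervalHull s ↔ ∃ a ∈ s, ∃ b ∈ s, a ≤ r ∧ r ≤ b := by
  simp only [intervalHull, Finset.mem_biUnion, Finset.mem_Icc]

theorem subset_intervalHull (s : Finset Λ) : s ⊆ intervalHull s :=
  fun r hr => mem_intervalHull.2 ⟨r, hr, r, hr, le_rfl, le_rfl⟩

theorem intervalHull_mono {s t : Finset Λ} (h : s ⊆ t) : intervalHull s ⊆ intervalHull t := by
  intro r hr
  obtain ⟨a, ha, b, hb, hab⟩ := mem_intervalHull.1 hr
  exact mem_intervalHull.2 ⟨a, h ha, b, h hb, hab⟩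

theorem ordConnected_intervalHull (s : Finset Λ) : (intervalHull s : Set Λ).OrdConnected where
  out' x hx y hy r hr := by
    obtain ⟨a, ha, -, -, hax, -⟩ := mem_intervalHull.1 hx
    obtain ⟨-, -, b, hb, -, hyb⟩ := mem_intervalHull.1 hy
    exact mem_intervalHull.2 ⟨a, ha, b, hb, hax.trans hr.1, hr.2.trans hyb⟩

end IntervalHull

namespace IsConvexInjection

open IncidenceAlgebra

variable {P : Type u} [Ring P] [TopologicalSpace P] [IsTopologicalRing P]
  {Γ₁ Γ₂ Δ Λ : Type u} [Preorder Γ₁] [LocallyFiniteOrder Γ₁] [DecidableEq Γ₁]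
  [Preorder Γ₂] [LocallyFiniteOrder Γ₂] [DecidableEq Γ₂]
  [Preorder Δ] [LocallyFiniteOrder Δ] [DecidableEq Δ]
  [Preorder Λ] [LocallyFiniteOrder Λ] [DecidableEq Λ]
  {g₁ : Γ₁ → Λ} {g₂ : Γ₂ → Λ} {h₁ : Δ → Γ₁} {h₂ : Δ → Γ₂}

/-- The restriction of matrices along an injection, as a morphism of topological rings. -/
def restrictHom (hg₁ : IsConvexInjection g₁) :
    TopRingCat.of (IncidenceAlgebra P Λ) ⟶ TopRingCat.of (IncidenceAlgebra P Γ₁) :=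
  ⟨hg₁.restrict, hg₁.continuous_restrict⟩

/-- The hypotheses say that `Γ₁`, `Γ₂`, `Δ` and `Λ` are four preorders on the same set, that of `Λ`
being the intersection of those of `Γ₁` and `Γ₂`. -/
theorem isPullback_restrictHom (hg₁ : IsConvexInjection g₁) (hg₂ : IsConvexInjection g₂)
    (hh₁ : IsConvexInjection h₁) (hh₂ : IsConvexInjection h₂)
    (comm : ∀ d, g₁ (h₁ d) = g₂ (h₂ d)) (hsurj : Function.Surjective (g₁ ∘ h₁))
    (hle : ∀ {a b}, h₁ a ≤ h₁ b → h₂ a ≤ h₂ b → g₁ (h₁ a) ≤ g₁ (h₁ b)) :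
    IsPullback (hg₁.restrictHom (P := P)) hg₂.restrictHom hh₁.restrictHom hh₂.restrictHom := by
  refine TopRingCat.isPullback_of_isEmbedding ?_ ?_ fun B C hBC => ?_
  · refine Subtype.ext (RingHom.ext fun A => IncidenceAlgebra.ext fun s t _ => ?_)
    exact congrArg₂ A (comm s) (comm t)
  · exact .of_comp (g := fun p (_ : Unit) => p.1)
      (hg₁.continuous_restrict.prodMk hg₂.continuous_restrict)
      (continuous_pi fun _ => continuous_fst)
      (isEmbedding_pi_restrict (fun _ => hg₁) fun s t => by
        obtain ⟨⟨a, ha⟩, ⟨b, hb⟩⟩ := hsurj s, hsurj t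
        exact ⟨(), h₁ a, h₁ b, ha, hb⟩)
  · choose d hd using hsurj
    have hd₁ (a : Γ₁) : h₁ (d (g₁ a)) = a := hg₁.injective (hd _)
    have hd₂ (a : Γ₂) : h₂ (d (g₂ a)) = a := hg₂.injective ((comm _).symm.trans (hd _))
    have hBC' (a b : Δ) : B (h₁ a) (h₁ b) = C (h₂ a) (h₂ b) :=
      congrArg (fun D : IncidenceAlgebra P Δ => D a b) hBC
    let A : IncidenceAlgebra P Λ := ⟨fun s t => B (h₁ (d s)) (h₁ (d t)), fun s t hst => by
      by_contra hB
      have hC : C (h₂ (d s)) (h₂ (d t)) ≠ 0 := hBC' _ _ ▸ hB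
      have hst' : (g₁ ∘ h₁) (d s) ≤ (g₁ ∘ h₁) (d t) := hle (le_of_ne_zero hB) (le_of_ne_zero hC)
      exact hst (by rwa [hd, hd] at hst')⟩
    refine ⟨A, IncidenceAlgebra.ext fun a b _ => ?_, IncidenceAlgebra.ext fun a b _ => ?_⟩
    · exact congrArg₂ B (hd₁ a) (hd₁ b)
    · exact (hBC' _ _).trans (congrArg₂ C (hd₂ a) (hd₂ b))

end IsConvexInjection

namespace WithUpperSets

variable {α : Type u} [Finite α] {U V : Set (Set α)} (P : Type u) [Ring P] [TopologicalSpace P]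
  [IsTopologicalRing P]

/-- The inclusion of the incidence ring of `WithUpperSets V` in that of `WithUpperSets U`, whose
preorder has more relations when `U ⊆ V`. -/
noncomputable def inclusionHom (h : U ⊆ V) :
    TopRingCat.of (IncidenceAlgebra P (WithUpperSets V)) ⟶
      TopRingCat.of (IncidenceAlgebra P (WithUpperSets U)) :=
  (isConvexInjection_reorder h).restrictHom

theorem isPullback_inclusionHom (U V : Set (Set α)) :
    IsPullback (inclusionHom P (Set.subset_union_left : U ⊆ U ∪ V))
      (inclusionHom P (Set.subset_union_right : V ⊆ U ∪ V))
      (inclusionHom P U.empty_subset) (inclusionHom P V.empty_subset) :=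
  (isConvexInjection_reorder Set.subset_union_left).isPullback_restrictHom
    (isConvexInjection_reorder Set.subset_union_right)
    (isConvexInjection_reorder U.empty_subset) (isConvexInjection_reorder V.empty_subset)
    (fun _ => rfl) ((reorder U _).surjective.comp (reorder ∅ U).surjective)
    fun hU hV u hu => hu.elim (hU u) (hV u)

end WithUpperSets

section InverseLimit

open IncidenceAlgebra IsConvexInjection

theorem apply_intervalHull_eq_of_restrict_eq {P Λ : Type*} [NonAssocSemiring P] [Preorder Λ]
    [LocallyFiniteOrder Λ] [DecidableEq Λ]
    {B : ∀ s : Finset Λ, IncidenceAlgebra P (intervalHull s : Set Λ)}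
    (hB : ∀ {s t} (h : s ⊆ t),
      (inclusion (ordConnected_intervalHull s) (intervalHull_mono h)).restrict (B t) = B s)
    {s t : Finset Λ} {a b : Λ} (has : a ∈ intervalHull s) (hbs : b ∈ intervalHull s)
    (hat : a ∈ intervalHull t) (hbt : b ∈ intervalHull t) :
    B s ⟨a, has⟩ ⟨b, hbs⟩ = B t ⟨a, hat⟩ ⟨b, hbt⟩ := by
  have hsub {s t : Finset Λ} (h : s ⊆ t) (has : a ∈ intervalHull s) (hbs : b ∈ intervalHull s) :
      B s ⟨a, has⟩ ⟨b, hbs⟩ =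
        B t ⟨a, intervalHull_mono h has⟩ ⟨b, intervalHull_mono h hbs⟩ := by
    rw [← hB h]
    rfl
  exact (hsub Finset.subset_union_left has hbs).trans
    (hsub Finset.subset_union_right hat hbt).symm

variable (P Λ : Type u) [Ring P] [TopologicalSpace P] [IsTopologicalRing P] [Preorder Λ]
  [LocallyFiniteOrder Λ] [DecidableEq Λ]

/-- The inverse system of the incidence rings of the finite order-convex subsets of `Λ`. It is
indexed by all finite subsets, each standing for its order-convex hull. -/
def intervalHullSystem : (Finset Λ)ᵒᵖ ⥤ TopRingCat.{u} where
  obj s := TopRingCat.of (IncidenceAlgebra P (intervalHull s.unop : Set Λ))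
  map f := (inclusion (ordConnected_intervalHull _) (intervalHull_mono f.unop.le)).restrictHom

/-- The cone over `intervalHullSystem` that consists of the restrictions of matrices in `M_Λ(P)`. -/
def intervalHullCone : Cone (intervalHullSystem P Λ) where
  pt := TopRingCat.of (IncidenceAlgebra P Λ)
  π := { app := fun s => (subtypeVal (ordConnected_intervalHull s.unop)).restrictHom }

variable {P Λ}

theorem nonempty_isLimit_intervalHullCone : Nonempty (IsLimit (intervalHullCone P Λ)) := by
  have hleft (a b : Λ) : a ∈ intervalHull {a, b} := subset_intervalHull _ (by simp)
  have hright (a b : Λ) : b ∈ intervalHull {a, b} := subset_intervalHull _ (by simp)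
  refine TopRingCat.nonempty_isLimit_of_isEmbedding _ ?_ fun A hA => ?_
  · exact isEmbedding_pi_restrict
      (fun s : (Finset Λ)ᵒᵖ => subtypeVal (ordConnected_intervalHull s.unop))
      fun a b => ⟨.op {a, b}, ⟨a, hleft a b⟩, ⟨b, hright a b⟩, rfl, rfl⟩
  · let B (s : Finset Λ) : IncidenceAlgebra P (intervalHull s : Set Λ) := A (.op s)
    refine ⟨(⟨fun a b => B {a, b} ⟨a, hleft a b⟩ ⟨b, hright a b⟩, fun a b hab => ?_⟩ :
      IncidenceAlgebra P Λ), fun s => ?_⟩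
    · exact apply_eq_zero_of_not_le
        (show ¬(⟨a, hleft a b⟩ : (intervalHull {a, b} : Set Λ)) ≤ ⟨b, hright a b⟩ from hab) _
    · refine IncidenceAlgebra.ext (α := (intervalHull s.unop : Set Λ)) fun a b _ => ?_
      exact apply_intervalHull_eq_of_restrict_eq (B := B) (fun h => hA (homOfLE h).op) _ _ a.2 b.2

end InverseLimit

section Generation

open IncidenceAlgebra IsConvexInjection

variable {P : Type u} [Ring P]

section TopologicalRing

variable [TopologicalSpace P] [IsTopologicalRing P]

theorem topIncidenceRings_of (Λ : Type u) [Preorder Λ] [LocallyFiniteOrder Λ] [DecidableEq Λ] :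
    topIncidenceRings P (TopRingCat.of (IncidenceAlgebra P Λ)) :=
  ⟨Λ, _, _, _, ⟨Iso.refl _⟩⟩

theorem generatedWithin_topBlockRings_of_orderIso_twoBlock {Λ : Type u} [Preorder Λ]
    [LocallyFiniteOrder Λ] [DecidableEq Λ] {m n : ℕ} (e : Λ ≃o TwoBlock m n) :
    GeneratedWithin (topIncidenceRings P) (topBlockRings P)
      (TopRingCat.of (IncidenceAlgebra P Λ)) :=
  .of_iso (TopRingCat.isoOfRingEquiv (restrictEquiv e.symm) (continuous_restrictEquiv _)
    (continuous_restrictEquiv_symm _)) (topIncidenceRings_of Λ) (.generator _ ⟨m, n, rfl⟩)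

theorem generatedWithin_topBlockRings_withUpperSets {α : Type u} [Finite α] (U : Set (Set α)) :
    GeneratedWithin (topIncidenceRings P) (topBlockRings P)
      (TopRingCat.of (IncidenceAlgebra P (WithUpperSets U))) := by
  obtain ⟨_, _, ⟨e⟩⟩ := WithUpperSets.exists_orderIso_twoBlock_empty (α := α)
  have hempty := generatedWithin_topBlockRings_of_orderIso_twoBlock (P := P) e
  induction U, U.toFinite using Set.Finite.induction_on with
  | empty => exact hempty
  | @insert u U _ _ ih =>
    obtain ⟨_, _, ⟨e⟩⟩ := WithUpperSets.exists_orderIso_twoBlock_singleton u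
    exact .pullback _ _ _ _ _ _ _ _ (WithUpperSets.isPullback_inclusionHom P {u} U)
      (topIncidenceRings_of _) (generatedWithin_topBlockRings_of_orderIso_twoBlock e) ih hempty

theorem generatedWithin_topBlockRings_of_finite (Λ : Type u) [Preorder Λ] [LocallyFiniteOrder Λ]
    [DecidableEq Λ] [Finite Λ] :
    GeneratedWithin (topIncidenceRings P) (topBlockRings P)
      (TopRingCat.of (IncidenceAlgebra P Λ)) :=
  .of_iso (TopRingCat.isoOfRingEquiv (restrictEquiv (WithUpperSets.orderIsoRangeIci Λ).symm)
    (continuous_restrictEquiv _) (continuous_restrictEquiv_symm _)) (topIncidenceRings_of Λ)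
    (generatedWithin_topBlockRings_withUpperSets _)

theorem generatedWithin_topBlockRings (Λ : Type u) [Preorder Λ] [LocallyFiniteOrder Λ]
    [DecidableEq Λ] :
    GeneratedWithin (topIncidenceRings P) (topBlockRings P)
      (TopRingCat.of (IncidenceAlgebra P Λ)) :=
  .inverseLimit (Finset Λ) (intervalHullSystem P Λ) (intervalHullCone P Λ)
    nonempty_isLimit_intervalHullCone (topIncidenceRings_of Λ)
    fun s => generatedWithin_topBlockRings_of_finite (intervalHull s.unop : Set Λ)

end TopologicalRing

theorem generatedWithin_blockRings (Λ : Type u) [Preorder Λ] [LocallyFiniteOrder Λ]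
    [DecidableEq Λ] :
    GeneratedWithin (incidenceRings P) (blockRings P) (RingCat.of (IncidenceAlgebra P Λ)) := by
  let : TopologicalSpace P := ⊥
  have : DiscreteTopology P := ⟨rfl⟩
  refine (generatedWithin_topBlockRings (P := P) Λ).map TopRingCat.forgetTopology ?_ ?_
  · rintro R ⟨Λ, _, _, _, ⟨e⟩⟩
    exact ⟨Λ, _, _, _, ⟨TopRingCat.forgetTopology.mapIso e⟩⟩
  · rintro _ ⟨m, n, rfl⟩
    exact ⟨m, n, rfl⟩

noncomputable instance instLocallyFiniteOrderULiftTwoBlock (m n : ℕ) :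
    LocallyFiniteOrder (ULift.{u} (TwoBlock m n)) :=
  haveI : DecidableLE (ULift.{u} (TwoBlock m n)) := Classical.decRel _
  Fintype.toLocallyFiniteOrder

theorem blockRings_le_incidenceRings : blockRings P ≤ incidenceRings P := by
  rintro _ ⟨m, n, rfl⟩
  exact ⟨ULift.{u} (TwoBlock m n), _, _, inferInstance,
    ⟨(restrictEquiv ULift.orderIso.{u, 0}).toRingCatIso⟩⟩

theorem topBlockRings_le_topIncidenceRings [TopologicalSpace P] [IsTopologicalRing P] :
    topBlockRings P ≤ topIncidenceRings P := by
  rintro _ ⟨m, n, rfl⟩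
  exact ⟨ULift.{u} (TwoBlock m n), _, _, inferInstance,
    ⟨TopRingCat.isoOfRingEquiv (restrictEquiv ULift.orderIso.{u, 0}) (continuous_restrictEquiv _)
      (continuous_restrictEquiv_symm _)⟩⟩

variable (P)

theorem generatedWithin_blockRings_eq :
    GeneratedWithin (incidenceRings P) (blockRings P) = incidenceRings P := by
  refine le_antisymm (GeneratedWithin.le_of_le blockRings_le_incidenceRings) ?_
  rintro R ⟨Λ, _, _, _, ⟨e⟩⟩
  exact .of_iso e ⟨Λ, _, _, _, ⟨e⟩⟩ (generatedWithin_blockRings Λ)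

theorem generatedWithin_topBlockRings_eq [TopologicalSpace P] [IsTopologicalRing P] :
    GeneratedWithin (topIncidenceRings P) (topBlockRings P) = topIncidenceRings P := by
  refine le_antisymm (GeneratedWithin.le_of_le topBlockRings_le_topIncidenceRings) ?_
  rintro R ⟨Λ, _, _, _, ⟨e⟩⟩
  exact .of_iso e ⟨Λ, _, _, _, ⟨e⟩⟩ (generatedWithin_topBlockRings Λ)

end Generation

theorem mainTheorem7_general (P : Type u) [Ring P] :
    ((∀ (Λ : Type u) [Preorder Λ] [LocallyFiniteOrder Λ] [DecidableEq Λ],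
        GeneratedWithin ⊤ (blockRings P) (RingCat.of (IncidenceAlgebra P Λ))) ∧
      GeneratedWithin (incidenceRings P) (blockRings P) = incidenceRings P) ∧
    ∀ [TopologicalSpace P] [IsTopologicalRing P],
      (∀ (Λ : Type u) [Preorder Λ] [LocallyFiniteOrder Λ] [DecidableEq Λ],
        GeneratedWithin ⊤ (topBlockRings P) (TopRingCat.of (IncidenceAlgebra P Λ))) ∧
      GeneratedWithin (topIncidenceRings P) (topBlockRings P) = topIncidenceRings P :=
  ⟨⟨fun Λ _ _ _ => GeneratedWithin.mono le_top _ (generatedWithin_blockRings Λ),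
      generatedWithin_blockRings_eq P⟩,
    ⟨fun Λ _ _ _ => GeneratedWithin.mono le_top _ (generatedWithin_topBlockRings Λ),
      generatedWithin_topBlockRings_eq P⟩⟩

theorem mainTheorem7 (P : Type u) [Ring P] :
    ((∀ (Λ : Type u) [PartialOrder Λ] [LocallyFiniteOrder Λ] [DecidableEq Λ],
        GeneratedWithin ⊤ (blockRings P) (RingCat.of (IncidenceAlgebra P Λ))) ∧
      GeneratedWithin (incidenceRings P) (blockRings P) = incidenceRings P) ∧
    ∀ [TopologicalSpace P] [IsTopologicalRing P],
      (∀ (Λ : Type u) [PartialOrder Λ] [LocallyFiniteOrder Λ] [DecidableEq Λ],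
        GeneratedWithin ⊤ (topBlockRings P) (TopRingCat.of (IncidenceAlgebra P Λ))) ∧
      GeneratedWithin (topIncidenceRings P) (topBlockRings P) = topIncidenceRings P :=
  ⟨⟨fun Λ => (mainTheorem7_general P).1.1 Λ, (mainTheorem7_general P).1.2⟩,
    ⟨fun Λ => (mainTheorem7_general P).2.1 Λ, (mainTheorem7_general P).2.2⟩⟩
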